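/- Let $K$ be a field of characteristic $0$ and let $A_1$ be the first Weyl algebra over $K$, i.e. the associative unital $K$-algebra generated by $p,q$ with the single relation $pq-qp=1$. The monomials $p^iq^j$ ($i,j\ge 0$) form a $K$-basis of $A_1$; let $\Phi:A_1\to K[X,Y]$ be the $K$-linear isomorphism with $\Phi(p^iq^j)=X^iY^j$. For $(\rho,\sigma)\in\mathbb{R}^2$ and $z\in A_1\setminus\{0\}$ with $\Phi(z)=\sum\alpha_{ij}X^iY^j$, put $\mathbf{v}_{\rho,\sigma}(z)=\max\{\rho i+\sigma j : \alpha_{ij}\neq 0\}$ and let \[\mathbf{f}_{\rho,\sigma}(z)=\sum_{\rho i+\sigma j=\mathbf{v}_{\rho,\sigma}(z)}\alpha_{ij}X^iY^j\in K[X,Y]\] be the $(\rho,\sigma)$-leading polynomial of $z$. For $f,g\in K[X,Y]$ let $\{f,g\}=\frac{\partial f}{\partial X}\frac{\partial g}{\partial Y}-\frac{\partial f}{\partial Y}\frac{\partial g}{\partial X}$. Proposition. Let $z,w\in A_1$ satisfy $[z,w]=zw-wz=1$, and suppose that $\{\mathbf{f}_{\rho,\sigma}(z),\mathbf{f}_{\rho,\sigma}(w)\}=1$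 for some $(\rho,\sigma)\in\mathbb{R}^2$ with $\rho+\sigma>0$. Then $z$ and $w$ generate $A_1$ as a $K$-algebra. -/

import Mathlib

noncomputable section

/-- Defining relation `p q = q p + 1` (that is, `[p, q] = 1`) of the first Weyl algebra, on the
free algebra on two letters (`0` for `p`, `1` for `q`). -/
inductive WeylRel (K : Type*) [CommRing K] :
    FreeAlgebra K (Fin 2) → FreeAlgebra K (Fin 2) → Prop
  | comm : WeylRel K
      (FreeAlgebra.ι K (0 : Fin 2) * FreeAlgebra.ι K (1 : Fin 2))
      (FreeAlgebra.ι K (1 : Fin 2) * FreeAlgebra.ι K (0 : Fin 2) + 1)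

/-- The first Weyl algebra `A₁ = K⟨p, q⟩ / (p q - q p - 1)`. -/
abbrev Weyl (K : Type*) [CommRing K] : Type _ := RingQuot (WeylRel K)

namespace Weyl

/-- The generator `p`. -/
def p (K : Type*) [CommRing K] : Weyl K :=
  RingQuot.mkAlgHom K (WeylRel K) (FreeAlgebra.ι K (0 : Fin 2))

/-- The generator `q`. -/
def q (K : Type*) [CommRing K] : Weyl K :=
  RingQuot.mkAlgHom K (WeylRel K) (FreeAlgebra.ι K (1 : Fin 2))

theorem p_mul_q (K : Type*) [CommRing K] : p K * q K = q K * p K + 1 := by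
  have h := RingQuot.mkAlgHom_rel K (WeylRel.comm (K := K))
  simpa [p, q] using h

/-- The linear map `K[X, Y] → A₁`, `∑ αᵢⱼ Xⁱ Yʲ ↦ ∑ αᵢⱼ pⁱ qʲ`
(`X` is the variable `0`, `Y` is the variable `1`). -/
def ofPoly (K : Type*) [CommRing K] : MvPolynomial (Fin 2) K →ₗ[K] Weyl K :=
  (MvPolynomial.basisMonomials (Fin 2) K).constr K
    (fun d => p K ^ d 0 * q K ^ d 1)

theorem ofPoly_monomial (K : Type*) [CommRing K] (d : Fin 2 →₀ ℕ) (a : K) :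
    ofPoly K (MvPolynomial.monomial d a) = a • (p K ^ d 0 * q K ^ d 1) := by
  have h : MvPolynomial.monomial d a = a • (MvPolynomial.basisMonomials (Fin 2) K) d := by
    simp [MvPolynomial.smul_monomial]
  rw [h, map_smul, ofPoly, Module.Basis.constr_basis]

theorem q_mul_p_pow (K : Type*) [CommRing K] (n : ℕ) :
    q K * p K ^ n = p K ^ n * q K - (n : K) • p K ^ (n - 1) := by
  induction n with
  | zero => simp
  | succ n ih =>
    have h : q K * p K = p K * q K - 1 := by rw [p_mul_q]; simp
    rw [pow_succ, ← mul_assoc, ih, sub_mul, mul_assoc, h, mul_sub, mul_one, smul_mul_assoc]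
    rcases n with _ | n
    · simp
    · simp only [Nat.add_sub_cancel, ← pow_succ, ← mul_assoc]
      push_cast
      module

/-- The representation of `A₁` on `K[X, Y]` in which `p` acts as multiplication by `X` and `q` as
`Y - ∂/∂X`; it shows that the monomials `pⁱ qʲ` are linearly independent. -/
def rep (K : Type*) [CommRing K] : Weyl K →ₐ[K] Module.End K (MvPolynomial (Fin 2) K) :=
  RingQuot.liftAlgHom K ⟨FreeAlgebra.lift K
    ![LinearMap.mulLeft K (MvPolynomial.X 0),
      LinearMap.mulLeft K (MvPolynomial.X 1) -
        ((MvPolynomial.pderiv (R := K) (0 : Fin 2)) :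
          MvPolynomial (Fin 2) K →ₗ[K] MvPolynomial (Fin 2) K)], by
    intro a b h
    induction h
    apply LinearMap.ext
    intro f
    simp [Module.End.mul_apply, MvPolynomial.pderiv_X_self]
    ring⟩

theorem rep_p (K : Type*) [CommRing K] :
    rep K (p K) = LinearMap.mulLeft K (MvPolynomial.X 0) := by
  simp [rep, p]

theorem rep_q (K : Type*) [CommRing K] :
    rep K (q K) = LinearMap.mulLeft K (MvPolynomial.X 1) -
        ((MvPolynomial.pderiv (R := K) (0 : Fin 2)) :
          MvPolynomial (Fin 2) K →ₗ[K] MvPolynomial (Fin 2) K) := by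
  simp [rep, q]

theorem rep_ofPoly_one (K : Type*) [CommRing K] (f : MvPolynomial (Fin 2) K) :
    rep K (ofPoly K f) 1 = f := by
  have hp : ∀ (n : ℕ) (g : MvPolynomial (Fin 2) K),
      (rep K (p K) ^ n) g = MvPolynomial.X 0 ^ n * g := by
    intro n
    induction n with
    | zero => simp
    | succ n ih => intro g; rw [pow_succ, Module.End.mul_apply, ih, rep_p]; simp; ring
  have hq : ∀ n : ℕ, (rep K (q K) ^ n) 1 = (MvPolynomial.X 1 ^ n : MvPolynomial (Fin 2) K) := by
    intro n
    induction n with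
    | zero => simp
    | succ n ih =>
      rw [pow_succ', Module.End.mul_apply, ih, rep_q]
      simp [MvPolynomial.pderiv_X_of_ne, Derivation.leibniz_pow]
      ring
  induction f using MvPolynomial.induction_on' with
  | monomial d a =>
    rw [ofPoly_monomial, map_smul, map_mul, map_pow, map_pow, LinearMap.smul_apply,
      Module.End.mul_apply, hq, hp, MvPolynomial.monomial_eq, MvPolynomial.smul_eq_C_mul]
    simp [Finsupp.prod_fintype]
  | add f g hf hg => simp [hf, hg]

theorem ofPoly_surjective (K : Type*) [CommRing K] : Function.Surjective (ofPoly K) := by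
  have hmon : ∀ i j : ℕ, p K ^ i * q K ^ j ∈ LinearMap.range (ofPoly K) := by
    intro i j
    refine ⟨MvPolynomial.monomial (Finsupp.single 0 i + Finsupp.single 1 j) 1, ?_⟩
    rw [ofPoly_monomial]
    simp
  have hp : ∀ x ∈ LinearMap.range (ofPoly K), p K * x ∈ LinearMap.range (ofPoly K) := by
    rintro _ ⟨f, rfl⟩
    induction f using MvPolynomial.induction_on' with
    | monomial d a =>
      rw [ofPoly_monomial, mul_smul_comm, ← mul_assoc, ← pow_succ']
      exact Submodule.smul_mem _ _ (hmon _ _)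
    | add f g hf hg => rw [map_add, mul_add]; exact Submodule.add_mem _ hf hg
  have hq : ∀ x ∈ LinearMap.range (ofPoly K), q K * x ∈ LinearMap.range (ofPoly K) := by
    rintro _ ⟨f, rfl⟩
    induction f using MvPolynomial.induction_on' with
    | monomial d a =>
      rw [ofPoly_monomial, mul_smul_comm, ← mul_assoc, q_mul_p_pow, sub_mul, mul_assoc,
        ← pow_succ', smul_mul_assoc]
      exact Submodule.smul_mem _ _ (Submodule.sub_mem _ (hmon _ _)
        (Submodule.smul_mem _ _ (hmon _ _)))
    | add f g hf hg => rw [map_add, mul_add]; exact Submodule.add_mem _ hf hg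
  have key : ∀ a : FreeAlgebra K (Fin 2), ∀ x ∈ LinearMap.range (ofPoly K),
      RingQuot.mkAlgHom K (WeylRel K) a * x ∈ LinearMap.range (ofPoly K) := by
    intro a
    induction a using FreeAlgebra.induction with
    | grade0 r =>
      intro x hx
      rw [AlgHom.commutes, ← Algebra.smul_def]
      exact Submodule.smul_mem _ _ hx
    | grade1 i =>
      intro x hx
      fin_cases i
      · exact hp x hx
      · exact hq x hx
    | mul a b ha hb =>
      intro x hx
      rw [map_mul, mul_assoc]
      exact ha _ (hb _ hx)
    | add a b ha hb =>
      intro x hx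
      rw [map_add, add_mul]
      exact Submodule.add_mem _ (ha _ hx) (hb _ hx)
  intro z
  obtain ⟨a, rfl⟩ := RingQuot.mkAlgHom_surjective K (WeylRel K) z
  have h1 : (1 : Weyl K) ∈ LinearMap.range (ofPoly K) := by simpa using hmon 0 0
  simpa using key a 1 h1

theorem ofPoly_bijective (K : Type*) [CommRing K] : Function.Bijective (ofPoly K) :=
  ⟨Function.LeftInverse.injective (g := fun z => rep K z 1) (rep_ofPoly_one K),
    ofPoly_surjective K⟩

/-- The linear identification `Φ : A₁ → K[X, Y]`, `pⁱ qʲ ↦ Xⁱ Yʲ`. -/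
def Phi (K : Type*) [CommRing K] : Weyl K ≃ₗ[K] MvPolynomial (Fin 2) K :=
  (LinearEquiv.ofBijective (ofPoly K) (ofPoly_bijective K)).symm

/-- The `(ρ, σ)`-degree `sup {ρ i + σ j | Xⁱ Yʲ occurs in f}` of a nonzero polynomial `f`. -/
def polyDeg {K : Type*} [CommRing K] (ρ σ : ℝ) (f : MvPolynomial (Fin 2) K) : ℝ :=
  sSup ((fun d : Fin 2 →₀ ℕ => ρ * (d 0 : ℝ) + σ * (d 1 : ℝ)) '' (f.support : Set (Fin 2 →₀ ℕ)))

open Classical in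
/-- The `(ρ, σ)`-leading component of a polynomial `f`: the sum of the terms of `f` whose
`(ρ, σ)`-degree is that of `f` (it is `0` for `f = 0`). -/
def polyLead {K : Type*} [CommRing K] (ρ σ : ℝ) (f : MvPolynomial (Fin 2) K) :
    MvPolynomial (Fin 2) K :=
  ∑ d ∈ f.support with ρ * (d 0 : ℝ) + σ * (d 1 : ℝ) = polyDeg ρ σ f,
    MvPolynomial.monomial d (f.coeff d)

/-- The polynomial `(ρ, σ)`-associated with `z ∈ A₁`. -/
def lead {K : Type*} [CommRing K] (ρ σ : ℝ) (z : Weyl K) : MvPolynomial (Fin 2) K :=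
  polyLead ρ σ (Phi K z)

/-- The Poisson bracket `{f, g} = f_X g_Y - f_Y g_X` on `K[X, Y]`. -/
def poisson {K : Type*} [CommRing K] (f g : MvPolynomial (Fin 2) K) : MvPolynomial (Fin 2) K :=
  MvPolynomial.pderiv 0 f * MvPolynomial.pderiv 1 g -
    MvPolynomial.pderiv 1 f * MvPolynomial.pderiv 0 g

end Weyl

end

/-! The constant term of the Poisson bracket involves only the linear coefficients of the two
leading polynomials. Since it is 1, after possibly exchanging `z` and `w` (the commutator becomes
-1), X occurs in the leading polynomial of `z` and Y in that of `w`. Hence `z` has degree ρ and `w`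
has degree σ, which confines both supports to half-planes.

If ρ = σ > 0, both elements are affine in p, q with invertible linear part. Otherwise the symmetry
exchanging p with q and `z` with `w` allows σ < ρ. If σ > 0, the half-planes already force `w` = aq
+ b and `z` = cp + f(q) with a, c nonzero, so q and then p are recovered.

If σ ≤ 0, the half-planes are i - 1 ≤ τj and k ≤ τ(l - 1) with τ = -σ/ρ in [0, 1). Shrink τ until it
is 0 or a boundary line meets a support in a new point. Commuting monomials yields only exponents (i
+ k - t, j + l - t) with t ≥ 1, and at t = 1 the coefficient il - jk. Since τ < 1, the topmost
boundary points (i, m) and (k, n) alone produce their extremal coefficient, and in - mk = n + τm >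
0. A scalar commutator permits this only at exponent (0, 0), so m = 0 and n = 1. No new point
exists, τ = 0, and the triangular shape returns (`DegenerateVertices.triangular_of_slope`,
`cf_commutator`). -/

namespace Weyl

/-! ### Combinatorics of supports in half-planes -/

/-- A pair of finite sets of exponents is degenerate at its vertices if, apart from the exponent
`(0, 0)`, any exponent of a commutator that only one pair of monomials can produce is produced
with coefficient zero. -/
def DegenerateVertices (S T : Finset (ℕ × ℕ)) : Prop :=
  ∀ i j k l A B : ℕ, (i, j) ∈ S → (k, l) ∈ T → i + k = A + 1 → j + l = B + 1 →
    (∀ i' j' k' l' t, (i', j') ∈ S → (k', l') ∈ T → 1 ≤ t →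
      i' + k' = A + t → j' + l' = B + t → i' = i ∧ j' = j ∧ k' = k ∧ l' = l) →
    i * l = j * k ∨ A = 0 ∧ B = 0

/-- The condition il = jk survives exchanging both coordinates and both sets; this reduces σ > ρ to
σ < ρ. -/
theorem DegenerateVertices.swap {S T : Finset (ℕ × ℕ)} (h : DegenerateVertices S T) :
    DegenerateVertices (T.image Prod.swap) (S.image Prod.swap) := by
  intro i j k l A B hT hS hA hB huniq
  simp only [Finset.mem_image, Prod.exists, Prod.swap_prod_mk, Prod.mk.injEq] at hS hT huniq
  obtain ⟨_, _, hS, rfl, rfl⟩ := hS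
  obtain ⟨_, _, hT, rfl, rfl⟩ := hT
  rcases h _ _ _ _ B A hS hT (by omega) (by omega) (fun i' j' k' l' t h1 h2 ht h3 h4 => by
    have := huniq l' k' j' i' t ⟨_, _, h2, rfl, rfl⟩ ⟨_, _, h1, rfl, rfl⟩ ht
      (by omega) (by omega)
    tauto) with h | h
  · left; linarith
  · tauto

/-- The topmost points on the two boundary lines form a pair with nonzero bracket, so degeneracy
forces them to be (1, 0) and (0, 1). Tightness of τ then leaves only τ = 0. -/
theorem DegenerateVertices.triangular_of_slope {S T : Finset (ℕ × ℕ)}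
    (h : DegenerateVertices S T) (hS : (1, 0) ∈ S) (hT : (0, 1) ∈ T) {τ : ℝ} (hτ0 : 0 ≤ τ)
    (hτ1 : τ < 1) (hSτ : ∀ i j : ℕ, (i, j) ∈ S → (i : ℝ) - 1 ≤ τ * j)
    (hTτ : ∀ k l : ℕ, (k, l) ∈ T → (k : ℝ) ≤ τ * (l - 1))
    (htight : τ = 0 ∨ (∃ i j : ℕ, (i, j) ∈ S ∧ 0 < j ∧ (i : ℝ) - 1 = τ * j) ∨
      ∃ k l : ℕ, (k, l) ∈ T ∧ 1 < l ∧ (k : ℝ) = τ * (l - 1)) :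
    (∀ i j, (i, j) ∈ S → i = 1 ∧ j = 0 ∨ i = 0) ∧ (∀ k l, (k, l) ∈ T → k = 0 ∧ l ≤ 1) := by
  classical
  obtain ⟨⟨i, m⟩, hS1, hSmax⟩ := Finset.exists_max_image
    (S.filter fun d => (d.1 : ℝ) - 1 = τ * d.2) Prod.snd ⟨(1, 0), by simp [hS]⟩
  obtain ⟨⟨k, n⟩, hT1, hTmax⟩ := Finset.exists_max_image
    (T.filter fun d => (d.1 : ℝ) = τ * ((d.2 : ℝ) - 1)) Prod.snd ⟨(0, 1), by simp [hT]⟩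
  simp only [Finset.mem_filter, and_imp, Prod.forall] at hS1 hSmax hT1 hTmax
  obtain ⟨him, hi⟩ := hS1
  obtain ⟨hkn, hk⟩ := hT1
  have hn : 1 ≤ n := hTmax 0 1 hT (by simp)
  have hτm : 0 ≤ τ * m := by positivity
  have hi1 : 1 ≤ i := by
    have : (1 : ℝ) ≤ i := by linarith
    exact_mod_cast this
  have key := h i m k n (i + k - 1) (m + n - 1) him hkn (by omega) (by omega) (by
    intro i' j' k' l' t h1 h2 ht h3 h4
    have e1 : (i' : ℝ) + k' = i + k - 1 + t := by
      have : i' + k' + 1 = i + k + t := by omega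
      have : ((i' + k' + 1 : ℕ) : ℝ) = (i + k + t : ℕ) := by rw [this]
      push_cast at this
      linarith
    have e2 : (j' : ℝ) + l' = m + n - 1 + t := by
      have : j' + l' + 1 = m + n + t := by omega
      have : ((j' + l' + 1 : ℕ) : ℝ) = (m + n + t : ℕ) := by rw [this]
      push_cast at this
      linarith
    have a1 := hSτ _ _ h1
    have a2 := hTτ _ _ h2
    have e3 : τ * j' + τ * l' = τ * m + τ * n - τ + τ * t := by
      linear_combination τ * e2
    have ht' : (1 : ℝ) ≤ t := by exact_mod_cast ht
    -- Adding the two half-plane inequalities, the chosen vertices contribute equality and only (t -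
    -- 1)(1 - τ) remains. So t = 1 and both competing points lie on the boundary lines.
    have ht1 : ((t : ℝ) - 1) * (1 - τ) ≤ 0 := by nlinarith
    have ht2 : (t : ℝ) = 1 := by
      by_contra hne
      have : (1 : ℝ) < t := lt_of_le_of_ne ht' (Ne.symm hne)
      nlinarith
    rw [ht2] at e1 e3
    have b1 : (i' : ℝ) - 1 = τ * j' := by linarith
    have b2 : (k' : ℝ) = τ * (l' - 1) := by linarith
    have c1 := hSmax _ _ h1 b1
    have c2 := hTmax _ _ h2 b2
    have ht3 : t = 1 := by exact_mod_cast ht2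
    obtain rfl : j' = m := by omega
    obtain rfl : l' = n := by omega
    have d1 : (i' : ℝ) = i := by linarith
    have d2 : (k' : ℝ) = k := by linarith
    exact ⟨by exact_mod_cast d1, rfl, by exact_mod_cast d2, rfl⟩)
  have hmn : m = 0 ∧ n = 1 := by
    rcases key with key | key
    · have key' : (i : ℝ) * n = m * k := by exact_mod_cast key
      have hn' : (1 : ℝ) ≤ n := by exact_mod_cast hn
      -- in - mk = (1 + τm)n - mτ(n - 1) = n + τm, which is positive.
      have : (n : ℝ) + τ * m = 0 := by
        have hi' : (i : ℝ) = 1 + τ * m := by linarith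
        rw [hi', hk] at key'
        linear_combination key'
      linarith
    · omega
  obtain ⟨rfl, rfl⟩ := hmn
  have hτ : τ = 0 := by
    rcases htight with h0 | ⟨i', j', h1, h2, h3⟩ | ⟨k', l', h1, h2, h3⟩
    · exact h0
    · have := hSmax _ _ h1 h3
      omega
    · have := hTmax _ _ h1 h3
      omega
  subst hτ
  simp only [zero_mul] at hSτ hTτ hSmax hTmax
  constructor
  · intro i' j' h'
    have h1 : i' ≤ 1 := by
      have := hSτ _ _ h'
      have : (i' : ℝ) ≤ 1 := by linarith
      exact_mod_cast this
    rcases Nat.le_one_iff_eq_zero_or_eq_one.mp h1 with rfl | rfl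
    · exact Or.inr rfl
    · exact Or.inl ⟨rfl, Nat.le_zero.mp (hSmax 1 j' h' (by simp))⟩
  · intro k' l' h'
    have h1 : (k' : ℝ) = 0 := le_antisymm (hTτ _ _ h') (Nat.cast_nonneg _)
    exact ⟨by exact_mod_cast h1, hTmax k' l' h' h1⟩

/-- The least admissible slope is attained, or zero. -/
theorem exists_least_slope {S T : Finset (ℕ × ℕ)} {τ : ℝ} (hτ0 : 0 ≤ τ)
    (hSτ : ∀ i j : ℕ, (i, j) ∈ S → (i : ℝ) - 1 ≤ τ * j)
    (hTτ : ∀ k l : ℕ, (k, l) ∈ T → (k : ℝ) ≤ τ * (l - 1)) :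
    ∃ τ₀ : ℝ, 0 ≤ τ₀ ∧ τ₀ ≤ τ ∧ (∀ i j : ℕ, (i, j) ∈ S → (i : ℝ) - 1 ≤ τ₀ * j) ∧
      (∀ k l : ℕ, (k, l) ∈ T → (k : ℝ) ≤ τ₀ * (l - 1)) ∧
      (τ₀ = 0 ∨ (∃ i j : ℕ, (i, j) ∈ S ∧ 0 < j ∧ (i : ℝ) - 1 = τ₀ * j) ∨
        ∃ k l : ℕ, (k, l) ∈ T ∧ 1 < l ∧ (k : ℝ) = τ₀ * (l - 1)) := by
  classical
  have hl0 : ∀ k : ℕ, (k, 0) ∈ T → τ = 0 ∧ k = 0 := by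
    intro k hk
    have h1 := hTτ k 0 hk
    have h2 : (0 : ℝ) ≤ k := Nat.cast_nonneg _
    push_cast at h1
    refine ⟨by linarith, ?_⟩
    have : (k : ℝ) = 0 := by linarith
    exact_mod_cast this
  -- The lower bounds that the points impose on the slope. Where j = 0 or l = 1 the quotient is 0 by
  -- division by zero, and where l = 0 it is 0 because k = 0; both are harmless, as 0 belongs to
  -- `R`.
  let R : Finset ℝ := insert 0 (S.image (fun d => ((d.1 : ℝ) - 1) / d.2) ∪
    T.image (fun d => (d.1 : ℝ) / (d.2 - 1)))
  obtain ⟨r, hrR, hr⟩ := R.exists_max_image id ⟨0, by simp [R]⟩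
  simp only [R, Finset.mem_insert, Finset.mem_union, Finset.mem_image, Prod.exists] at hrR hr
  simp only [id] at hr
  have hr0 : 0 ≤ r := hr 0 (Or.inl rfl)
  have hrτ : r ≤ τ := by
    rcases hrR with rfl | ⟨i, j, hij, rfl⟩ | ⟨k, l, hkl, rfl⟩
    · exact hτ0
    · rcases Nat.eq_zero_or_pos j with rfl | hj
      · simpa using hτ0
      · rw [div_le_iff₀ (by exact_mod_cast hj)]
        exact hSτ i j hij
    · rcases lt_trichotomy l 1 with hl | rfl | hl
      · obtain rfl : l = 0 := by omega
        obtain ⟨-, rfl⟩ := hl0 k hkl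
        simpa using hτ0
      · simpa using hτ0
      · have : (1 : ℝ) < l := by exact_mod_cast hl
        rw [div_le_iff₀ (by linarith)]
        exact hTτ k l hkl
  refine ⟨r, hr0, hrτ, ?_, ?_, ?_⟩
  · intro i j hij
    rcases Nat.eq_zero_or_pos j with rfl | hj
    · simpa using hSτ i 0 hij
    · rw [← div_le_iff₀ (by exact_mod_cast hj)]
      exact hr _ (Or.inr (Or.inl ⟨i, j, hij, rfl⟩))
  · intro k l hkl
    rcases lt_trichotomy l 1 with hl | rfl | hl
    · obtain rfl : l = 0 := by omega
      obtain ⟨h1, rfl⟩ := hl0 k hkl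
      have : r = 0 := by linarith
      simp [this]
    · simpa using hTτ k 1 hkl
    · have : (1 : ℝ) < l := by exact_mod_cast hl
      rw [← div_le_iff₀ (by linarith)]
      exact hr _ (Or.inr (Or.inr ⟨k, l, hkl, rfl⟩))
  · rcases hrR with rfl | ⟨i, j, hij, rfl⟩ | ⟨k, l, hkl, rfl⟩
    · exact Or.inl rfl
    · rcases Nat.eq_zero_or_pos j with rfl | hj
      · simp
      · refine Or.inr (Or.inl ⟨i, j, hij, hj, ?_⟩)
        have : (j : ℝ) ≠ 0 := by exact_mod_cast hj.ne'
        rw [div_mul_cancel₀ _ this]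
    · rcases lt_trichotomy l 1 with hl | rfl | hl
      · obtain rfl : l = 0 := by omega
        obtain ⟨-, rfl⟩ := hl0 k hkl
        simp
      · simp
      · have : (1 : ℝ) < l := by exact_mod_cast hl
        refine Or.inr (Or.inr ⟨k, l, hkl, hl, ?_⟩)
        rw [div_mul_cancel₀ _ (by linarith)]

theorem DegenerateVertices.triangular {S T : Finset (ℕ × ℕ)}
    (h : DegenerateVertices S T) (hS : (1, 0) ∈ S) (hT : (0, 1) ∈ T) {ρ σ : ℝ}
    (hρσ : 0 < ρ + σ) (hlt : σ < ρ)
    (hSdeg : ∀ i j : ℕ, (i, j) ∈ S → ρ * i + σ * j ≤ ρ)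
    (hTdeg : ∀ k l : ℕ, (k, l) ∈ T → ρ * k + σ * l ≤ σ) :
    (∀ i j, (i, j) ∈ S → i = 1 ∧ j = 0 ∨ i = 0) ∧ (∀ k l, (k, l) ∈ T → k = 0 ∧ l ≤ 1) := by
  have hρ : 0 < ρ := by linarith
  rcases lt_or_ge 0 σ with hσ | hσ
  · constructor
    · intro i j hij
      have h1 := hSdeg i j hij
      rcases Nat.eq_zero_or_pos i with rfl | hi
      · exact Or.inr rfl
      left
      have hi' : (1 : ℝ) ≤ i := by exact_mod_cast hi
      have hj' : (0 : ℝ) ≤ j := Nat.cast_nonneg _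
      have hσj : 0 ≤ σ * j := by positivity
      constructor
      · have : (i : ℝ) ≤ 1 := by nlinarith
        have : i ≤ 1 := by exact_mod_cast this
        omega
      · have : (j : ℝ) ≤ 0 := by nlinarith
        have : j ≤ 0 := by exact_mod_cast this
        omega
    · intro k l hkl
      have h1 := hTdeg k l hkl
      have hk' : (0 : ℝ) ≤ k := Nat.cast_nonneg _
      have hl' : (0 : ℝ) ≤ l := Nat.cast_nonneg _
      have hσl : 0 ≤ σ * l := by positivity
      have hρk : 0 ≤ ρ * k := by positivity
      constructor
      · have : (k : ℝ) < 1 := by nlinarith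
        have : k < 1 := by exact_mod_cast this
        omega
      · have : (l : ℝ) ≤ 1 := by nlinarith
        exact_mod_cast this
  -- Dividing the degree bounds by ρ gives slope -σ/ρ, which is below 1 exactly because ρ + σ > 0.
  · have hτ0 : 0 ≤ -σ / ρ := div_nonneg (by linarith) hρ.le
    have hτ1 : -σ / ρ < 1 := by rw [div_lt_one hρ]; linarith
    have hρτ : ρ * (-σ / ρ) = -σ := by field_simp
    obtain ⟨τ, h0, h1, h2, h3, h4⟩ := exists_least_slope (S := S) (T := T) hτ0
      (fun i j hij => by
        have := hSdeg i j hij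
        refine le_of_mul_le_mul_left ?_ hρ
        rw [← mul_assoc, hρτ]
        linarith)
      (fun k l hkl => by
        have := hTdeg k l hkl
        refine le_of_mul_le_mul_left ?_ hρ
        rw [← mul_assoc, hρτ]
        linarith)
    exact h.triangular_of_slope hS hT h0 (h1.trans_lt hτ1) h2 h3 h4

/-! ### Coefficients and supports in the Weyl algebra -/

variable {K : Type*} [Field K]

theorem ofPoly_Phi (z : Weyl K) : ofPoly K (Phi K z) = z :=
  (Phi K).symm_apply_apply z

theorem Phi_p_pow_mul_q_pow (i j : ℕ) :
    Phi K (p K ^ i * q K ^ j) =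
      MvPolynomial.monomial (Finsupp.single 0 i + Finsupp.single 1 j) 1 := by
  apply (Phi K).symm.injective
  rw [LinearEquiv.symm_apply_apply]
  change _ = ofPoly K _
  rw [ofPoly_monomial]
  simp

/-- The coefficient of `pⁱ qʲ` in an element of the Weyl algebra. -/
noncomputable def cf (z : Weyl K) (i j : ℕ) : K :=
  (Phi K z).coeff (Finsupp.single 0 i + Finsupp.single 1 j)

theorem cf_add (z w : Weyl K) (i j : ℕ) : cf (z + w) i j = cf z i j + cf w i j := by
  simp [cf]

theorem cf_sub (z w : Weyl K) (i j : ℕ) : cf (z - w) i j = cf z i j - cf w i j := by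
  simp [cf]

theorem cf_smul (a : K) (z : Weyl K) (i j : ℕ) : cf (a • z) i j = a * cf z i j := by
  simp [cf]

theorem cf_zero (i j : ℕ) : cf (0 : Weyl K) i j = 0 := by
  simp [cf]

theorem cf_sum {ι : Type*} (s : Finset ι) (f : ι → Weyl K) (i j : ℕ) :
    cf (∑ x ∈ s, f x) i j = ∑ x ∈ s, cf (f x) i j := by
  simp [cf, MvPolynomial.coeff_sum]

theorem cf_monomial (i j k l : ℕ) :
    cf (p K ^ i * q K ^ j) k l = if i = k ∧ j = l then 1 else 0 := by
  rw [cf, Phi_p_pow_mul_q_pow, MvPolynomial.coeff_monomial]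
  congr 1
  rw [eq_iff_iff]
  constructor
  · intro h
    have h0 := DFunLike.congr_fun h 0
    have h1 := DFunLike.congr_fun h 1
    simp at h0 h1
    exact ⟨h0, h1⟩
  · rintro ⟨rfl, rfl⟩
    rfl

theorem single_add_single_eq (d : Fin 2 →₀ ℕ) :
    Finsupp.single 0 (d 0) + Finsupp.single 1 (d 1) = d := by
  ext i
  fin_cases i <;> simp

/-- The exponents `(i, j)` of the monomials `pⁱ qʲ` that occur in `z`. -/
noncomputable def supp (z : Weyl K) : Finset (ℕ × ℕ) :=
  (Phi K z).support.image fun d => (d 0, d 1)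

theorem mem_supp {z : Weyl K} {i j : ℕ} : (i, j) ∈ supp z ↔ cf z i j ≠ 0 := by
  simp only [supp, Finset.mem_image, MvPolynomial.mem_support_iff, Prod.mk.injEq, cf]
  constructor
  · rintro ⟨d, hd, rfl, rfl⟩
    rwa [single_add_single_eq]
  · intro h
    exact ⟨_, h, by simp, by simp⟩

theorem eq_sum_supp (z : Weyl K) :
    z = ∑ d ∈ supp z, cf z d.1 d.2 • (p K ^ d.1 * q K ^ d.2) := by
  rw [supp, Finset.sum_image]
  · conv_lhs => rw [← ofPoly_Phi z, (Phi K z).as_sum, map_sum]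
    refine Finset.sum_congr rfl fun d _ => ?_
    rw [ofPoly_monomial, cf, single_add_single_eq]
  · intro d _ e _ h
    rw [← single_add_single_eq d, ← single_add_single_eq e]
    simp only [Prod.mk.injEq] at h
    rw [h.1, h.2]

/-! ### Normal ordering and commutators of monomials -/

/-- The span of the monomials `pᵃ⁻ᵗ qᵇ⁻ᵗ` with `t ≥ n`. -/
noncomputable def lower (K : Type*) [Field K] (a b n : ℕ) : Submodule K (Weyl K) :=
  Submodule.span K {x | ∃ t i j, n ≤ t ∧ i + t = a ∧ j + t = b ∧ x = p K ^ i * q K ^ j}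

theorem lower_antitone (a b : ℕ) {m n : ℕ} (h : m ≤ n) : lower K a b n ≤ lower K a b m := by
  apply Submodule.span_mono
  rintro x ⟨t, i, j, ht, h3⟩
  exact ⟨t, i, j, h.trans ht, h3⟩

theorem lower_succ_le (a b n : ℕ) : lower K a b n ≤ lower K (a + 1) (b + 1) (n + 1) := by
  apply Submodule.span_mono
  rintro x ⟨t, i, j, ht, hi, hj, rfl⟩
  exact ⟨t + 1, i, j, by omega, by omega, by omega, rfl⟩

theorem p_pow_mul_mul_q_pow_mem_lower {a b n : ℕ} {x : Weyl K} (hx : x ∈ lower K a b n)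
    (i l : ℕ) : p K ^ i * x * q K ^ l ∈ lower K (i + a) (b + l) n := by
  induction hx using Submodule.span_induction with
  | mem x h =>
    obtain ⟨t, i', j', ht, hi, hj, rfl⟩ := h
    apply Submodule.subset_span
    refine ⟨t, i + i', j' + l, ht, by omega, by omega, ?_⟩
    rw [pow_add, pow_add]
    simp only [mul_assoc]
  | zero => simp
  | add x y _ _ hx hy => rw [mul_add, add_mul]; exact add_mem hx hy
  | smul c x _ hx => rw [mul_smul_comm, smul_mul_assoc]; exact Submodule.smul_mem _ _ hx

theorem exists_of_mem_lower {a b n : ℕ} {x : Weyl K} (hx : x ∈ lower K a b n) {A B : ℕ}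
    (h : cf x A B ≠ 0) : ∃ t, n ≤ t ∧ A + t = a ∧ B + t = b := by
  contrapose! h
  induction hx using Submodule.span_induction with
  | mem x hx =>
    obtain ⟨t, i', j', ht, hi, hj, rfl⟩ := hx
    rw [cf_monomial, if_neg]
    rintro ⟨rfl, rfl⟩
    exact h t ht hi hj
  | zero => exact cf_zero _ _
  | add x y _ _ hx hy => rw [cf_add, hx, hy, add_zero]
  | smul c x _ hx => rw [cf_smul, hx, mul_zero]

theorem q_pow_succ_mul_p_pow (j k : ℕ) :
    q K ^ (j + 1) * p K ^ k =
      q K ^ j * p K ^ k * q K - (k : K) • (q K ^ j * p K ^ (k - 1)) := by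
  rw [pow_succ, mul_assoc, q_mul_p_pow, mul_sub, mul_smul_comm, mul_assoc]

theorem q_pow_mul_p_pow_sub_mem (j k : ℕ) :
    q K ^ j * p K ^ k - p K ^ k * q K ^ j ∈ lower K k j 1 := by
  -- The cruder bound at level 0 suffices for the correction term of the recursion, whose exponents
  -- are already one lower.
  have mem0 : ∀ j k : ℕ, q K ^ j * p K ^ k ∈ lower K k j 0 := by
    intro j
    induction j with
    | zero => exact fun k => Submodule.subset_span ⟨0, k, 0, by simp, by simp, by simp, by simp⟩
    | succ j ih =>
      intro k
      rw [q_pow_succ_mul_p_pow]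
      refine sub_mem (by simpa using p_pow_mul_mul_q_pow_mem_lower (ih k) 0 1) ?_
      rcases k with _ | k
      · simp
      · exact Submodule.smul_mem _ _ (lower_antitone _ _ (Nat.zero_le 1) (lower_succ_le _ _ _ (ih k)))
  induction j with
  | zero => simp
  | succ j ih =>
    have h : q K ^ (j + 1) * p K ^ k - p K ^ k * q K ^ (j + 1) =
        (q K ^ j * p K ^ k - p K ^ k * q K ^ j) * q K -
          (k : K) • (q K ^ j * p K ^ (k - 1)) := by
      rw [q_pow_succ_mul_p_pow, sub_mul, pow_succ, mul_assoc (p K ^ k)]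
      abel
    rw [h]
    refine sub_mem (by simpa using p_pow_mul_mul_q_pow_mem_lower ih 0 1) ?_
    rcases k with _ | k
    · simp
    · exact Submodule.smul_mem _ _ (lower_succ_le _ _ _ (mem0 j k))

/-- Each q moved past pᵏ costs k pᵏ⁻¹ to first order, and j of them add up. Truncated subtraction is
harmless: the coefficient jk vanishes when j or k is 0. -/
theorem q_pow_mul_p_pow_sub_add_mem (j k : ℕ) :
    q K ^ j * p K ^ k - p K ^ k * q K ^ j + (j * k : K) • (p K ^ (k - 1) * q K ^ (j - 1)) ∈
      lower K k j 2 := by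
  induction j with
  | zero => simp
  | succ j ih =>
    have hq : (j * k : K) • (p K ^ (k - 1) * q K ^ (j - 1) * q K) =
        (j * k : K) • (p K ^ (k - 1) * q K ^ j) := by
      rcases j with _ | j
      · simp
      · rw [mul_assoc, Nat.add_sub_cancel, ← pow_succ]
    have h : q K ^ (j + 1) * p K ^ k - p K ^ k * q K ^ (j + 1) +
          ((j + 1 : ℕ) * k : K) • (p K ^ (k - 1) * q K ^ (j + 1 - 1)) =
        (q K ^ j * p K ^ k - p K ^ k * q K ^ j +
          (j * k : K) • (p K ^ (k - 1) * q K ^ (j - 1))) * q K -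
          (k : K) • (q K ^ j * p K ^ (k - 1) - p K ^ (k - 1) * q K ^ j) := by
      rw [q_pow_succ_mul_p_pow, add_mul, smul_mul_assoc, hq, sub_mul, pow_succ,
        mul_assoc (p K ^ k), Nat.add_sub_cancel]
      push_cast
      module
    rw [h]
    refine sub_mem (by simpa using p_pow_mul_mul_q_pow_mem_lower ih 0 1) ?_
    rcases k with _ | k
    · simp
    · exact Submodule.smul_mem _ _ (lower_succ_le _ _ _ (q_pow_mul_p_pow_sub_mem j k))

/-- The commutator of two monomials. -/
noncomputable def comm (K : Type*) [Field K] (i j k l : ℕ) : Weyl K :=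
  p K ^ i * q K ^ j * (p K ^ k * q K ^ l) - p K ^ k * q K ^ l * (p K ^ i * q K ^ j)

/-- Both products share the normally ordered term of exponent (i + k, j + l), which cancels, leaving
only reordering errors. -/
theorem comm_eq (i j k l : ℕ) :
    comm K i j k l =
      p K ^ i * (q K ^ j * p K ^ k - p K ^ k * q K ^ j) * q K ^ l -
        p K ^ k * (q K ^ l * p K ^ i - p K ^ i * q K ^ l) * q K ^ j := by
  have h : p K ^ i * (p K ^ k * q K ^ j) * q K ^ l = p K ^ k * (p K ^ i * q K ^ l) * q K ^ j := by
    calc _ = p K ^ i * p K ^ k * (q K ^ j * q K ^ l) := by simp only [mul_assoc]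
      _ = p K ^ k * p K ^ i * (q K ^ l * q K ^ j) := by
        rw [(Commute.pow_pow_self (p K) i k).eq, (Commute.pow_pow_self (q K) j l).eq]
      _ = _ := by simp only [mul_assoc]
  rw [comm, mul_sub, mul_sub, sub_mul, sub_mul, h]
  simp only [mul_assoc]
  abel

theorem comm_mem_lower (i j k l : ℕ) : comm K i j k l ∈ lower K (i + k) (j + l) 1 := by
  rw [comm_eq]
  refine sub_mem (p_pow_mul_mul_q_pow_mem_lower (q_pow_mul_p_pow_sub_mem j k) i l) ?_
  rw [add_comm i, add_comm j]
  exact p_pow_mul_mul_q_pow_mem_lower (q_pow_mul_p_pow_sub_mem l i) k j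

theorem cf_normal_order {i j k l A B : ℕ} (hA : i + k = A + 1) (hB : j + l = B + 1) :
    cf (p K ^ i * (q K ^ j * p K ^ k - p K ^ k * q K ^ j) * q K ^ l) A B = -(j * k) := by
  have h := p_pow_mul_mul_q_pow_mem_lower (q_pow_mul_p_pow_sub_add_mem (K := K) j k) i l
  have h0 : cf (p K ^ i * (q K ^ j * p K ^ k - p K ^ k * q K ^ j +
      (j * k : K) • (p K ^ (k - 1) * q K ^ (j - 1))) * q K ^ l) A B = 0 := by
    by_contra hne
    obtain ⟨t, ht, h1, -⟩ := exists_of_mem_lower h hne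
    omega
  rw [mul_add, add_mul, cf_add, mul_smul_comm, smul_mul_assoc, cf_smul] at h0
  rcases j with _ | j
  · simpa using h0
  rcases k with _ | k
  · simpa using h0
  have h1 : p K ^ i * (p K ^ (k + 1 - 1) * q K ^ (j + 1 - 1)) * q K ^ l =
      p K ^ A * q K ^ B := by
    rw [show A = i + k by omega, show B = j + l by omega, pow_add, pow_add]
    simp only [mul_assoc, Nat.add_sub_cancel]
  rw [h1, cf_monomial, if_pos ⟨rfl, rfl⟩, mul_one] at h0
  exact eq_neg_of_add_eq_zero_left h0

theorem cf_comm {i j k l A B : ℕ} (hA : i + k = A + 1) (hB : j + l = B + 1) :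
    cf (comm K i j k l) A B = i * l - j * k := by
  rw [comm_eq, cf_sub, cf_normal_order hA hB, cf_normal_order (by omega) (by omega)]
  ring

theorem commutator_eq_sum (z w : Weyl K) :
    z * w - w * z =
      ∑ d ∈ supp z, ∑ e ∈ supp w, (cf z d.1 d.2 * cf w e.1 e.2) • comm K d.1 d.2 e.1 e.2 := by
  conv_lhs => rw [eq_sum_supp z, eq_sum_supp w]
  rw [Finset.sum_mul_sum, Finset.sum_mul_sum, Finset.sum_comm (s := supp w),
    ← Finset.sum_sub_distrib]
  refine Finset.sum_congr rfl fun d _ => ?_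
  rw [← Finset.sum_sub_distrib]
  refine Finset.sum_congr rfl fun e _ => ?_
  rw [comm, smul_sub, smul_mul_smul_comm, smul_mul_smul_comm, mul_comm (cf w _ _)]

/-- If only one pair of monomials can contribute to the coefficient of `p^A q^B` in a
commutator, then that coefficient is given by the Poisson bracket of the pair. -/
theorem cf_commutator {z w : Weyl K} {i j k l A B : ℕ} (hA : i + k = A + 1) (hB : j + l = B + 1)
    (hz : (i, j) ∈ supp z) (hw : (k, l) ∈ supp w)
    (huniq : ∀ i' j' k' l' t, (i', j') ∈ supp z → (k', l') ∈ supp w → 1 ≤ t →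
      i' + k' = A + t → j' + l' = B + t → i' = i ∧ j' = j ∧ k' = k ∧ l' = l) :
    cf (z * w - w * z) A B = cf z i j * cf w k l * (i * l - j * k) := by
  have hc : ∀ d ∈ supp z, ∀ e ∈ supp w, (d ≠ (i, j) ∨ e ≠ (k, l)) →
      cf (comm K d.1 d.2 e.1 e.2) A B = 0 := by
    rintro ⟨i', j'⟩ hd ⟨k', l'⟩ he hne
    by_contra h
    obtain ⟨t, ht, h1, h2⟩ := exists_of_mem_lower (comm_mem_lower i' j' k' l') h
    obtain ⟨rfl, rfl, rfl, rfl⟩ := huniq i' j' k' l' t hd he ht h1.symm h2.symm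
    simp at hne
  rw [commutator_eq_sum, cf_sum, Finset.sum_eq_single_of_mem _ hz, cf_sum,
    Finset.sum_eq_single_of_mem _ hw, cf_smul, cf_comm hA hB]
  · intro e he hne
    rw [cf_smul, hc _ hz _ he (Or.inr hne), mul_zero]
  · intro d hd hne
    rw [cf_sum]
    refine Finset.sum_eq_zero fun e he => ?_
    rw [cf_smul, hc _ hd _ he (Or.inl hne), mul_zero]

/-- A scalar has no coefficient away from (0, 0), so an isolated contribution there must vanish;
characteristic 0 turns il - jk = 0 in `K` into an equality of naturals. -/
theorem degenerateVertices_supp [CharZero K] {z w : Weyl K} {c : K}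
    (h : z * w - w * z = algebraMap K _ c) : DegenerateVertices (supp z) (supp w) := by
  intro i j k l A B hz hw hA hB huniq
  rw [or_iff_not_imp_right]
  intro hAB
  have h1 := cf_commutator hA hB hz hw huniq
  have h2 : cf (1 : Weyl K) A B = 0 := by
    have := cf_monomial (K := K) 0 0 A B
    rw [pow_zero, pow_zero, one_mul] at this
    rw [this, if_neg]
    rintro ⟨rfl, rfl⟩
    exact hAB ⟨rfl, rfl⟩
  rw [h, Algebra.algebraMap_eq_smul_one, cf_smul, h2, mul_zero] at h1
  have h3 : (i * l - j * k : K) = 0 :=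
    (mul_eq_zero.mp h1.symm).resolve_left (mul_ne_zero (mem_supp.mp hz) (mem_supp.mp hw))
  exact_mod_cast sub_eq_zero.mp h3

/-! ### Recovering the generators from triangular or linear pairs -/

theorem adjoin_p_q : Algebra.adjoin K {p K, q K} = ⊤ := by
  rw [eq_top_iff]
  intro z _
  rw [eq_sum_supp z]
  exact sum_mem fun d _ => Subalgebra.smul_mem _ (mul_mem
    (pow_mem (Algebra.subset_adjoin (by simp)) _)
    (pow_mem (Algebra.subset_adjoin (by simp)) _)) _

theorem eq_top_of_p_mem_of_q_mem {R : Subalgebra K (Weyl K)} (hp : p K ∈ R) (hq : q K ∈ R) :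
    R = ⊤ := by
  rw [eq_top_iff, ← adjoin_p_q, Algebra.adjoin_le_iff]
  rintro x (rfl | rfl) <;> assumption

theorem monomial_mem_of_mem {R : Subalgebra K (Weyl K)} {z : Weyl K} (hz : z ∈ R) {i j : ℕ}
    (hij : (i, j) ∈ supp z)
    (h : ∀ k l, (k, l) ∈ supp z → (k, l) ≠ (i, j) → p K ^ k * q K ^ l ∈ R) :
    p K ^ i * q K ^ j ∈ R := by
  have h1 : ∑ d ∈ (supp z).erase (i, j), cf z d.1 d.2 • (p K ^ d.1 * q K ^ d.2) ∈ R := by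
    refine sum_mem fun d hd => Subalgebra.smul_mem _ ?_ _
    rw [Finset.mem_erase] at hd
    exact h d.1 d.2 hd.2 hd.1
  have h2 := eq_sum_supp z
  rw [← Finset.add_sum_erase _ _ hij] at h2
  have h3 : cf z i j • (p K ^ i * q K ^ j) ∈ R := by
    rw [eq_sub_iff_add_eq.mpr h2.symm]
    exact sub_mem hz h1
  have h4 := Subalgebra.smul_mem _ h3 (cf z i j)⁻¹
  rwa [smul_smul, inv_mul_cancel₀ (mem_supp.mp hij), one_smul] at h4

theorem eq_top_of_triangular {R : Subalgebra K (Weyl K)} {z w : Weyl K} (hz : z ∈ R) (hw : w ∈ R)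
    (hz1 : (1, 0) ∈ supp z) (hw1 : (0, 1) ∈ supp w)
    (hzs : ∀ i j, (i, j) ∈ supp z → i = 1 ∧ j = 0 ∨ i = 0)
    (hws : ∀ k l, (k, l) ∈ supp w → k = 0 ∧ l ≤ 1) : R = ⊤ := by
  have hq : q K ∈ R := by
    have := monomial_mem_of_mem hw hw1 (fun k l hkl hne => by
      obtain ⟨rfl, hl⟩ := hws k l hkl
      have : l ≠ 1 := fun h => hne (by rw [h])
      obtain rfl : l = 0 := by omega
      simp)
    simpa using this
  have hp : p K ∈ R := by
    have := monomial_mem_of_mem hz hz1 (fun i j hij hne => by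
      rcases hzs i j hij with ⟨rfl, rfl⟩ | rfl
      · exact absurd rfl hne
      · simpa using pow_mem hq j)
    simpa using this
  exact eq_top_of_p_mem_of_q_mem hp hq

theorem eq_top_of_triangular' {R : Subalgebra K (Weyl K)} {z w : Weyl K} (hz : z ∈ R) (hw : w ∈ R)
    (hz1 : (1, 0) ∈ supp z) (hw1 : (0, 1) ∈ supp w)
    (hws : ∀ k l, (k, l) ∈ supp w → l = 1 ∧ k = 0 ∨ l = 0)
    (hzs : ∀ i j, (i, j) ∈ supp z → j = 0 ∧ i ≤ 1) : R = ⊤ := by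
  have hp : p K ∈ R := by
    have := monomial_mem_of_mem hz hz1 (fun i j hij hne => by
      obtain ⟨rfl, hi⟩ := hzs i j hij
      have : i ≠ 1 := fun h => hne (by rw [h])
      obtain rfl : i = 0 := by omega
      simp)
    simpa using this
  have hq : q K ∈ R := by
    have := monomial_mem_of_mem hw hw1 (fun k l hkl hne => by
      rcases hws k l hkl with ⟨rfl, rfl⟩ | rfl
      · exact absurd rfl hne
      · simpa using pow_mem hp k)
    simpa using this
  exact eq_top_of_p_mem_of_q_mem hp hq

theorem eq_of_supp_subset_linear {z : Weyl K}
    (h : ∀ i j, (i, j) ∈ supp z → i + j ≤ 1) :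
    z = cf z 1 0 • p K + cf z 0 1 • q K + cf z 0 0 • 1 := by
  have hsub : supp z ⊆ {(1, 0), (0, 1), (0, 0)} := by
    rintro ⟨i, j⟩ hij
    have := h i j hij
    simp only [Finset.mem_insert, Finset.mem_singleton, Prod.mk.injEq]
    omega
  conv_lhs => rw [eq_sum_supp z]
  rw [Finset.sum_subset hsub]
  · rw [Finset.sum_insert (by simp), Finset.sum_insert (by simp), Finset.sum_singleton]
    simp [add_assoc]
  · rintro ⟨i, j⟩ _ hij
    rw [mem_supp, not_not] at hij
    rw [hij, zero_smul]

theorem eq_top_of_linear {R : Subalgebra K (Weyl K)} {z w : Weyl K} (hz : z ∈ R) (hw : w ∈ R)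
    (hzs : ∀ i j, (i, j) ∈ supp z → i + j ≤ 1) (hws : ∀ i j, (i, j) ∈ supp w → i + j ≤ 1)
    (hdet : cf z 1 0 * cf w 0 1 - cf z 0 1 * cf w 1 0 ≠ 0) : R = ⊤ := by
  have h1 := eq_of_supp_subset_linear hzs
  have h2 := eq_of_supp_subset_linear hws
  generalize cf z 1 0 = a at *
  generalize cf z 0 1 = b at *
  generalize cf w 1 0 = c at *
  generalize cf w 0 1 = d at *
  have hz' : a • p K + b • q K ∈ R := by
    rw [eq_sub_iff_add_eq.mpr h1.symm]
    exact sub_mem hz (Subalgebra.smul_mem _ (one_mem R) _)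
  have hw' : c • p K + d • q K ∈ R := by
    rw [eq_sub_iff_add_eq.mpr h2.symm]
    exact sub_mem hw (Subalgebra.smul_mem _ (one_mem R) _)
  have key : ∀ x : Weyl K, (a * d - b * c) • x ∈ R → x ∈ R := by
    intro x hx
    have := Subalgebra.smul_mem _ hx (a * d - b * c)⁻¹
    rwa [smul_smul, inv_mul_cancel₀ hdet, one_smul] at this
  refine eq_top_of_p_mem_of_q_mem (key _ ?_) (key _ ?_)
  · have := sub_mem (Subalgebra.smul_mem _ hz' d) (Subalgebra.smul_mem _ hw' b)
    convert this using 1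
    module
  · have := sub_mem (Subalgebra.smul_mem _ hw' a) (Subalgebra.smul_mem _ hz' c)
    convert this using 1
    module

/-- The scalar `c` is left general so that the lemma covers both orders of the pair. The determinant
matters only for ρ = σ, where p and q have equal degree. -/
theorem eq_top_of_degree_bounds [CharZero K] {R : Subalgebra K (Weyl K)} {z w : Weyl K}
    (hz : z ∈ R) (hw : w ∈ R) {c : K} (hc : z * w - w * z = algebraMap K _ c) {ρ σ : ℝ}
    (hρσ : 0 < ρ + σ) (hz1 : (1, 0) ∈ supp z) (hw1 : (0, 1) ∈ supp w)
    (hzdeg : ∀ i j : ℕ, (i, j) ∈ supp z → ρ * i + σ * j ≤ ρ)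
    (hwdeg : ∀ i j : ℕ, (i, j) ∈ supp w → ρ * i + σ * j ≤ σ)
    (hdet : ρ = σ → cf z 1 0 * cf w 0 1 - cf z 0 1 * cf w 1 0 ≠ 0) : R = ⊤ := by
  have hdeg := degenerateVertices_supp hc
  rcases lt_trichotomy σ ρ with h | h | h
  · obtain ⟨h1, h2⟩ := hdeg.triangular hz1 hw1 hρσ h hzdeg hwdeg
    exact eq_top_of_triangular hz hw hz1 hw1 h1 h2
  · subst h
    have hσ : 0 < σ := by linarith
    have key : ∀ i j : ℕ, σ * i + σ * j ≤ σ → i + j ≤ 1 := by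
      intro i j hij
      have : ((i + j : ℕ) : ℝ) ≤ (1 : ℕ) := by
        push_cast
        refine le_of_mul_le_mul_left ?_ hσ
        linarith
      exact_mod_cast this
    exact eq_top_of_linear hz hw (fun i j hij => key i j (hzdeg i j hij))
      (fun i j hij => key i j (hwdeg i j hij)) (hdet rfl)
  · have mem_swap : ∀ (S : Finset (ℕ × ℕ)) (i j : ℕ), (i, j) ∈ S.image Prod.swap ↔ (j, i) ∈ S := by
      intro S i j
      simp [Finset.mem_image]
    obtain ⟨h1, h2⟩ := hdeg.swap.triangular ((mem_swap _ _ _).2 hw1) ((mem_swap _ _ _).2 hz1)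
      (ρ := σ) (σ := ρ) (by linarith) h
      (fun i j hij => by linarith [hwdeg j i ((mem_swap _ _ _).1 hij)])
      (fun i j hij => by linarith [hzdeg j i ((mem_swap _ _ _).1 hij)])
    exact eq_top_of_triangular' hz hw hz1 hw1 (fun i j hij => h1 j i ((mem_swap _ _ _).2 hij))
      (fun i j hij => h2 j i ((mem_swap _ _ _).2 hij))

/-! ### Linear coefficients of leading polynomials -/

theorem coeff_polyLead (ρ σ : ℝ) (f : MvPolynomial (Fin 2) K) (d : Fin 2 →₀ ℕ)
    (h : (polyLead ρ σ f).coeff d ≠ 0) :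
    (polyLead ρ σ f).coeff d = f.coeff d ∧ f.coeff d ≠ 0 ∧
      ρ * (d 0 : ℝ) + σ * (d 1 : ℝ) = polyDeg ρ σ f := by
  classical
  rw [polyLead, MvPolynomial.coeff_sum] at h ⊢
  simp only [MvPolynomial.coeff_monomial] at h ⊢
  rw [Finset.sum_ite_eq'] at h ⊢
  split_ifs at h ⊢ with hd
  · rw [Finset.mem_filter] at hd
    exact ⟨rfl, h, hd.2⟩
  · exact absurd rfl h

theorem coeff_polyLead_of_degree (ρ σ : ℝ) (f : MvPolynomial (Fin 2) K) (d : Fin 2 →₀ ℕ)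
    (h : ρ * (d 0 : ℝ) + σ * (d 1 : ℝ) = polyDeg ρ σ f) :
    (polyLead ρ σ f).coeff d = f.coeff d := by
  classical
  rw [polyLead, MvPolynomial.coeff_sum]
  simp only [MvPolynomial.coeff_monomial]
  rw [Finset.sum_ite_eq']
  split_ifs with hd
  · rfl
  · rw [Finset.mem_filter, not_and] at hd
    by_contra hne
    exact hd (MvPolynomial.mem_support_iff.mpr (Ne.symm hne)) h

theorem degree_le_polyDeg (ρ σ : ℝ) (z : Weyl K) {i j : ℕ} (h : (i, j) ∈ supp z) :
    ρ * i + σ * j ≤ polyDeg ρ σ (Phi K z) := by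
  simp only [supp, Finset.mem_image, Prod.mk.injEq] at h
  obtain ⟨d, hd, rfl, rfl⟩ := h
  exact le_csSup ((Finset.finite_toSet _).image _).bddAbove ⟨d, hd, rfl⟩

theorem constantCoeff_poisson (f g : MvPolynomial (Fin 2) K) :
    MvPolynomial.constantCoeff (poisson f g) =
      f.coeff (Finsupp.single 0 1) * g.coeff (Finsupp.single 1 1) -
        f.coeff (Finsupp.single 1 1) * g.coeff (Finsupp.single 0 1) := by
  have h : ∀ (i : Fin 2) (f : MvPolynomial (Fin 2) K),
      MvPolynomial.constantCoeff (MvPolynomial.pderiv i f) = f.coeff (Finsupp.single i 1) := by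
    intro i f
    rw [MvPolynomial.constantCoeff_eq, MvPolynomial.coeff_pderiv]
    simp
  rw [poisson, map_sub, map_mul, map_mul, h, h, h, h]

theorem coeff_lead_X {ρ σ : ℝ} {z : Weyl K} (h : (lead ρ σ z).coeff (Finsupp.single 0 1) ≠ 0) :
    (1, 0) ∈ supp z ∧ polyDeg ρ σ (Phi K z) = ρ := by
  obtain ⟨-, h1, h2⟩ := coeff_polyLead ρ σ _ _ h
  exact ⟨mem_supp.mpr (by simpa [cf] using h1), by simpa using h2.symm⟩

theorem coeff_lead_Y {ρ σ : ℝ} {z : Weyl K} (h : (lead ρ σ z).coeff (Finsupp.single 1 1) ≠ 0) :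
    (0, 1) ∈ supp z ∧ polyDeg ρ σ (Phi K z) = σ := by
  obtain ⟨-, h1, h2⟩ := coeff_polyLead ρ σ _ _ h
  exact ⟨mem_supp.mpr (by simpa [cf] using h1), by simpa using h2.symm⟩

theorem eq_top_of_coeff_lead [CharZero K] {R : Subalgebra K (Weyl K)} {z w : Weyl K}
    (hz : z ∈ R) (hw : w ∈ R) {c : K} (hc : z * w - w * z = algebraMap K _ c) {ρ σ : ℝ}
    (hρσ : 0 < ρ + σ) (hzX : (lead ρ σ z).coeff (Finsupp.single 0 1) ≠ 0)
    (hwY : (lead ρ σ w).coeff (Finsupp.single 1 1) ≠ 0)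
    (hdet : (lead ρ σ z).coeff (Finsupp.single 0 1) * (lead ρ σ w).coeff (Finsupp.single 1 1) -
        (lead ρ σ z).coeff (Finsupp.single 1 1) * (lead ρ σ w).coeff (Finsupp.single 0 1) ≠ 0) :
    R = ⊤ := by
  obtain ⟨hz1, hzdeg⟩ := coeff_lead_X hzX
  obtain ⟨hw1, hwdeg⟩ := coeff_lead_Y hwY
  refine eq_top_of_degree_bounds hz hw hc hρσ hz1 hw1
    (fun i j hij => (degree_le_polyDeg ρ σ z hij).trans_eq hzdeg)
    (fun i j hij => (degree_le_polyDeg ρ σ w hij).trans_eq hwdeg) ?_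
  -- When ρ = σ, X and Y both have the top degree, so the linear coefficients of the leading
  -- polynomials are those of `z` and `w`.
  rintro rfl
  rw [lead, lead, coeff_polyLead_of_degree, coeff_polyLead_of_degree,
    coeff_polyLead_of_degree, coeff_polyLead_of_degree] at hdet
  · simpa [cf] using hdet
  all_goals simp [hzdeg, hwdeg]

end Weyl

theorem proposition93 {K : Type*} [Field K] [CharZero K] (z w : Weyl K)
    (hzw : z * w - w * z = 1) (ρ σ : ℝ) (hρσ : 0 < ρ + σ)
    (hlead : Weyl.poisson (Weyl.lead ρ σ z) (Weyl.lead ρ σ w) = 1) :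
    Algebra.adjoin K {z, w} = (⊤ : Subalgebra K (Weyl K)) := by
  have hz : z ∈ Algebra.adjoin K {z, w} := Algebra.subset_adjoin (by simp)
  have hw : w ∈ Algebra.adjoin K {z, w} := Algebra.subset_adjoin (by simp)
  have h := Weyl.constantCoeff_poisson (Weyl.lead ρ σ z) (Weyl.lead ρ σ w)
  rw [hlead, map_one] at h
  -- A difference of two products equal to 1 has a nonzero product; which one decides the roles of
  -- `z` and `w`.
  by_cases h0 : (Weyl.lead ρ σ z).coeff (Finsupp.single 0 1) *
      (Weyl.lead ρ σ w).coeff (Finsupp.single 1 1) = 0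
  · have h1 : (Weyl.lead ρ σ z).coeff (Finsupp.single 1 1) *
        (Weyl.lead ρ σ w).coeff (Finsupp.single 0 1) ≠ 0 := by
      intro h1
      rw [h0, h1, sub_zero] at h
      exact one_ne_zero h
    refine Weyl.eq_top_of_coeff_lead hw hz (c := -1) ?_ hρσ (right_ne_zero_of_mul h1)
      (left_ne_zero_of_mul h1) ?_
    · rw [map_neg, map_one, ← hzw, neg_sub]
    · intro h2
      have : (1 : K) = 0 := by linear_combination h - h2
      exact one_ne_zero this
  · refine Weyl.eq_top_of_coeff_lead hz hw (c := 1) ?_ hρσ (left_ne_zero_of_mul h0)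
      (right_ne_zero_of_mul h0) ?_
    · rw [map_one, hzw]
    · rw [← h]
      exact one_ne_zero
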